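/- A hypergraph $\mathcal H=(V,E)$ consists of a finite vertex set $V$ and a set $E$ of nonempty subsets of $V$, its edges. In the Maker-Breaker game on $\mathcal H$, Maker and Breaker alternately claim unclaimed vertices, Maker moving first, until all vertices are claimed; Maker wins if he has claimed all vertices of some edge, and otherwise (that is, if Breaker has claimed a vertex of every edge) Breaker wins. A player wins the game on $\mathcal H$ if that player has a winning strategy. The hypergraph $\mathcal H$ is Maker-Breaker critical if Maker wins the game on $\mathcal H$ but, for every $e\in E$, Breaker wins the game on $\mathcal H-e=(V,E\setminus\{e\})$; it is an atomic Maker-Breaker critical hypergraph if, in addition, every vertex belongs to at least one edge. Given two vertex-disjoint hypergraphs $\mathcal H_1,\mathcal H_2$, edges $e_1$ of $\mathcal H_1$ and $e_2$ of $\mathcal H_2$, and a new vertex $z\notin V(\mathcal H_1)\cup V(\mathcal H_2)$, let $(\mathcal H_1,e_1)+(\mathcal H_2,e_2)$ be the hypergraph with vertex set $V(\mathcal H_1)\cup V(\mathcal H_2)\cup\{z\}$ and edge set \[ \bigl(E(\mathcal H_1)\cup E(\mathcal H_2)\cup\{e_1\cup\{z\},\,e_2\cup\{z\}\}\bigr)\setminus\{e_1,e_2\}.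 \] Let $\mathcal L$ be the minimal family of hypergraphs such that (i) every hypergraph with exactly one vertex $v$ and exactly one edge $\{v\}$ belongs to $\mathcal L$; and (ii) if $\mathcal H_1,\mathcal H_2\in\mathcal L$ are vertex-disjoint and $e_i$ is an arbitrary edge of $\mathcal H_i$ for $i\in\{1,2\}$, then $(\mathcal H_1,e_1)+(\mathcal H_2,e_2)\in\mathcal L$, for every choice of the new vertex $z$. Then every hypergraph in $\mathcal L$ is an atomic Maker-Breaker critical hypergraph. -/

import Mathlib

namespace Hypergraph

/-! ### The Maker-Breaker game

The board is the vertex set, the winning sets are the edges. A position consists of the set `M` of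
vertices claimed by Maker, the set `B` of vertices claimed by Breaker, and the player to move.
The game ends when the whole board is claimed. "The player can force a win from this position" is
defined inductively (the player has a good move when it is his turn, and every move of the
opponent is good for him when it is the opponent's turn). -/

/-- The two players. -/
inductive Player where
  | maker
  | breaker

/-- The vertices that nobody has claimed yet. -/
def unclaimed {α : Type*} (H : Hypergraph α) (M B : Set α) : Set α :=
  V(H) \ (M ∪ B)

/-- Maker has a winning strategy from the position `(p, M, B)`: at the end of the game Maker will
have claimed all elements of some edge. -/
inductive MakerForces {α : Type*} (H : Hypergraph α) : Player → Set α → Set α → Prop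
  | gameOver {p : Player} {M B : Set α} (hfull : H.unclaimed M B = ∅)
      (hwin : ∃ e ∈ E(H), e ⊆ M) : MakerForces H p M B
  | makerMove {M B : Set α} (x : α) (hx : x ∈ H.unclaimed M B)
      (h : MakerForces H .breaker (insert x M) B) : MakerForces H .maker M B
  | breakerMove {M B : Set α} (hfree : (H.unclaimed M B).Nonempty)
      (h : ∀ x ∈ H.unclaimed M B, MakerForces H .maker M (insert x B)) :
      MakerForces H .breaker M B

/-- Breaker has a winning strategy from the position `(p, M, B)`: at the end of the game Breaker
will have claimed an element of every edge. -/
inductive BreakerForces {α : Type*} (H : Hypergraph α) : Player → Set α → Set α → Prop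
  | gameOver {p : Player} {M B : Set α} (hfull : H.unclaimed M B = ∅)
      (hwin : ∀ e ∈ E(H), (e ∩ B).Nonempty) : BreakerForces H p M B
  | breakerMove {M B : Set α} (x : α) (hx : x ∈ H.unclaimed M B)
      (h : BreakerForces H .maker M (insert x B)) : BreakerForces H .breaker M B
  | makerMove {M B : Set α} (hfree : (H.unclaimed M B).Nonempty)
      (h : ∀ x ∈ H.unclaimed M B, BreakerForces H .breaker (insert x M) B) :
      BreakerForces H .maker M B

/-- Maker wins the Maker-Breaker game on `H` (Maker starts, the board is unclaimed). -/
def MakerWins {α : Type*} (H : Hypergraph α) : Prop :=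
  H.MakerForces .maker ∅ ∅

/-- Breaker wins the Maker-Breaker game on `H` (Maker starts, the board is unclaimed). -/
def BreakerWins {α : Type*} (H : Hypergraph α) : Prop :=
  H.BreakerForces .maker ∅ ∅

/-! ### Critical hypergraphs -/

/-- The hypergraph `H - e`: the edge `e` is removed, all vertices are kept. -/
def deleteEdge {α : Type*} (H : Hypergraph α) (e : Set α) : Hypergraph α where
  vertexSet := V(H)
  edgeSet := E(H) \ {e}
  subset_vertexSet_of_mem_edgeSet' := fun _ hf => H.subset_vertexSet_of_mem_edgeSet' hf.1

/-- `H` is a Maker-Breaker critical hypergraph: it is a game hypergraph (finite board, nonempty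
winning sets) on which Maker wins, and Breaker wins on `H - e` for every edge `e`. -/
structure IsMakerBreakerCritical {α : Type*} (H : Hypergraph α) : Prop where
  finite_vertexSet : V(H).Finite
  nonempty_of_mem_edgeSet : ∀ e ∈ E(H), e.Nonempty
  makerWins : H.MakerWins
  breakerWins_deleteEdge : ∀ e ∈ E(H), (H.deleteEdge e).BreakerWins

/-- An atomic Maker-Breaker critical hypergraph is one without isolated vertices. -/
structure IsAtomicMakerBreakerCritical {α : Type*} (H : Hypergraph α) : Prop
    extends IsMakerBreakerCritical H where
  not_isIsolated : ∀ x ∈ V(H), ¬ H.IsIsolated x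

/-! ### The family `ℒ` -/

/-- The 1-uniform hypergraph with exactly one vertex `v` and exactly one edge `{v}`. -/
def oneVertex {α : Type*} (v : α) : Hypergraph α where
  vertexSet := {v}
  edgeSet := {{v}}
  subset_vertexSet_of_mem_edgeSet' := by
    rintro e rfl
    exact subset_rfl

/-- The hypergraph `(H₁, e₁) + (H₂, e₂)`: the vertex `z` is added to the vertex set and to the
specified edges `e₁` and `e₂`. It is used for disjoint `H₁`, `H₂` and for `z` outside both. -/
def join {α : Type*} (H₁ H₂ : Hypergraph α) (e₁ e₂ : Set α) (he₁ : e₁ ∈ E(H₁)) (he₂ : e₂ ∈ E(H₂))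
    (z : α) : Hypergraph α where
  vertexSet := V(H₁) ∪ V(H₂) ∪ {z}
  edgeSet := (E(H₁) ∪ E(H₂) ∪ {e₁ ∪ {z}, e₂ ∪ {z}}) \ {e₁, e₂}
  subset_vertexSet_of_mem_edgeSet' := by
    have h₁ : ∀ e ∈ E(H₁), e ⊆ V(H₁) := fun _ h => H₁.subset_vertexSet_of_mem_edgeSet' h
    have h₂ : ∀ e ∈ E(H₂), e ⊆ V(H₂) := fun _ h => H₂.subset_vertexSet_of_mem_edgeSet' h
    rintro e ⟨(h | h) | rfl | rfl, -⟩ x hx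
    · exact .inl (.inl (h₁ e h hx))
    · exact .inl (.inr (h₂ e h hx))
    · exact hx.imp (fun hx => .inl (h₁ e₁ he₁ hx)) id
    · exact hx.imp (fun hx => .inr (h₂ e₂ he₂ hx)) id

/-- The family `ℒ`: the smallest family of hypergraphs that contains every one-vertex 1-uniform
hypergraph and is closed under `(H₁, e₁) + (H₂, e₂)`, with a new vertex `z`, for vertex-disjoint
members `H₁`, `H₂` and arbitrary edges `e₁` of `H₁` and `e₂` of `H₂`. -/
inductive FamilyL {α : Type*} : Hypergraph α → Prop
  | oneVertex (v : α) : FamilyL (oneVertex v)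
  | join {H₁ H₂ : Hypergraph α} (h₁ : FamilyL H₁) (h₂ : FamilyL H₂)
      (hdisj : Disjoint V(H₁) V(H₂)) {e₁ e₂ : Set α} (he₁ : e₁ ∈ E(H₁)) (he₂ : e₂ ∈ E(H₂))
      {z : α} (hz : z ∉ V(H₁) ∪ V(H₂)) : FamilyL (join H₁ H₂ e₁ e₂ he₁ he₂ z)

end Hypergraph

namespace Hypergraph

variable {α : Type*}

/-! Maker wins on a join by claiming `z`: both extended edges then shrink back to `e₁` and `e₂`,
Breaker's reply touches at most one summand, and Maker recurses in an untouched one. For the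
induction, `FamilyL.makerForces` lets the member of `ℒ` sit inside a larger, partly played board.
Breaker wins on `H - e` by a pairing strategy. `FamilyL.exists_isPairingAvoiding` builds the pairing
along the construction of `ℒ`; requiring that `e` keep an unpaired vertex leaves a partner for the
new vertex `z`. -/

theorem unclaimed_insert_left (H : Hypergraph α) (M B : Set α) (x : α) :
    H.unclaimed (insert x M) B = H.unclaimed M B \ {x} := by
  ext y
  simp only [unclaimed, Set.mem_sdiff, Set.mem_union, Set.mem_insert_iff, Set.mem_singleton_iff]
  tauto

theorem unclaimed_insert_right (H : Hypergraph α) (M B : Set α) (x : α) :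
    H.unclaimed M (insert x B) = H.unclaimed M B \ {x} := by
  ext y
  simp only [unclaimed, Set.mem_sdiff, Set.mem_union, Set.mem_insert_iff, Set.mem_singleton_iff]
  tauto

/-- A position in which Maker has already claimed a whole edge is won for Maker. -/
theorem MakerForces.of_edge_subset {H : Hypergraph α} {e : Set α} (he : e ∈ E(H)) :
    ∀ (n : ℕ) (p : Player) (M B : Set α), (H.unclaimed M B).Finite →
      (H.unclaimed M B).ncard = n → e ⊆ M → H.MakerForces p M B := by
  intro n
  -- Play stops only on a full board, so after an edge is complete the remaining moves are made
  -- arbitrarily.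
  induction n with
  | zero =>
    intro p M B hfin hn heM
    exact .gameOver ((Set.ncard_eq_zero hfin).1 hn) ⟨e, he, heM⟩
  | succ n ih =>
    intro p M B hfin hn heM
    have hne : (H.unclaimed M B).Nonempty := Set.nonempty_of_ncard_ne_zero (by omega)
    cases p with
    | maker =>
      obtain ⟨x, hx⟩ := hne
      refine .makerMove x hx (ih _ _ _ ?_ ?_ (heM.trans (Set.subset_insert x M)))
      · rw [unclaimed_insert_left]
        exact hfin.sdiff
      · rw [unclaimed_insert_left, Set.ncard_sdiff_singleton_of_mem hx]
        omega
    | breaker =>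
      refine .breakerMove hne fun x hx => ih _ _ _ ?_ ?_ heM
      · rw [unclaimed_insert_right]
        exact hfin.sdiff
      · rw [unclaimed_insert_right, Set.ncard_sdiff_singleton_of_mem hx]
        omega

/-! ### Pairing strategies -/

/-- A pairing: a symmetric relation that relates each vertex to at most one vertex, which is a
different one. -/
structure IsPairing (R : α → α → Prop) : Prop where
  symm : ∀ {x y}, R x y → R y x
  ne : ∀ {x y}, R x y → x ≠ y
  unique : ∀ {x y z}, R x y → R x z → y = z

/-- In each pair, either Breaker owns an element or both elements are unclaimed. -/
def PairsSafe (H : Hypergraph α) (R : α → α → Prop) (M B : Set α) : Prop :=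
  ∀ x y, R x y → x ∈ B ∨ y ∈ B ∨ (x ∈ H.unclaimed M B ∧ y ∈ H.unclaimed M B)

theorem PairsSafe.insert_breaker {H : Hypergraph α} {R : α → α → Prop} {M B : Set α}
    (h : PairsSafe H R M B) (u : α) : PairsSafe H R M (insert u B) := by
  intro x y hxy
  rw [unclaimed_insert_right]
  simp only [Set.mem_insert_iff, Set.mem_sdiff, Set.mem_singleton_iff]
  have := h x y hxy
  tauto

/-- Breaker's pairing strategy. -/
theorem BreakerForces.of_pairing {H : Hypergraph α} {R : α → α → Prop} (hR : IsPairing R)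
    (hE : ∀ e ∈ E(H), ∃ x ∈ e, ∃ y ∈ e, R x y) :
    ∀ (n : ℕ) (M B : Set α), (H.unclaimed M B).Finite → (H.unclaimed M B).ncard = n →
      PairsSafe H R M B → H.BreakerForces .maker M B := by
  have hover : ∀ (p : Player) (M B : Set α), H.unclaimed M B = ∅ →
      (∀ x y, R x y → x ∈ B ∨ y ∈ B) → H.BreakerForces p M B := by
    refine fun p M B h0 h => .gameOver h0 fun e he => ?_
    obtain ⟨x, hx, y, hy, hxy⟩ := hE e he
    exact (h x y hxy).elim (fun hB => ⟨x, hx, hB⟩) fun hB => ⟨y, hy, hB⟩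
  intro n
  -- Strong induction, because a full round uses up two vertices.
  induction n using Nat.strong_induction_on with
  | _ n ih =>
  intro M B hfin hn hsafe
  by_cases hne : (H.unclaimed M B).Nonempty
  swap
  · rw [Set.not_nonempty_iff_eq_empty] at hne
    refine hover _ _ _ hne fun x y hxy => ?_
    have := hsafe x y hxy
    simp only [hne, Set.mem_empty_iff_false, false_and, or_false] at this
    exact this
  refine .makerMove hne fun x hx => ?_
  have hreply : ∀ u ∈ H.unclaimed (insert x M) B, PairsSafe H R (insert x M) (insert u B) →
      H.BreakerForces .breaker (insert x M) B := by
    intro u hu hs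
    refine .breakerMove u hu (ih _ ?_ _ _ ?_ rfl hs)
    · rw [unclaimed_insert_right, unclaimed_insert_left, ← hn]
      exact Set.ncard_lt_ncard
        ⟨Set.sdiff_subset.trans Set.sdiff_subset, fun h => (h hx).1.2 rfl⟩ hfin
    · rw [unclaimed_insert_right, unclaimed_insert_left]
      exact hfin.sdiff.sdiff
  -- Breaker answers `x` with its unclaimed partner. If there is none, Maker's move spoils no pair,
  -- and any reply will do.
  by_cases hy : ∃ y, R x y ∧ y ∈ H.unclaimed M B
  · obtain ⟨y, hxy, hyU⟩ := hy
    refine hreply y ?_ ?_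
    · rw [unclaimed_insert_left]
      exact ⟨hyU, fun h => hR.ne hxy h.symm⟩
    · intro a b hab
      rw [unclaimed_insert_right, unclaimed_insert_left]
      simp only [Set.mem_insert_iff, Set.mem_sdiff, Set.mem_singleton_iff]
      by_cases hax : a = x
      · subst hax
        exact .inr (.inl (.inl (hR.unique hab hxy)))
      by_cases hbx : b = x
      · subst hbx
        exact .inl (.inl (hR.unique (hR.symm hab) hxy))
      have := hsafe a b hab
      tauto
  · have hs : PairsSafe H R (insert x M) B := by
      intro a b hab
      rw [unclaimed_insert_left]
      simp only [Set.mem_sdiff, Set.mem_singleton_iff]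
      have h := hsafe a b hab
      have ha : a = x → b ∉ H.unclaimed M B := fun hax hb => hy ⟨b, hax ▸ hab, hb⟩
      have hb : b = x → a ∉ H.unclaimed M B := fun hbx ha => hy ⟨a, hbx ▸ hR.symm hab, ha⟩
      tauto
    by_cases hne' : (H.unclaimed (insert x M) B).Nonempty
    · obtain ⟨u, hu⟩ := hne'
      exact hreply u hu (hs.insert_breaker u)
    · rw [Set.not_nonempty_iff_eq_empty] at hne'
      refine hover _ _ _ hne' fun a b hab => ?_
      have := hs a b hab
      simp only [hne', Set.mem_empty_iff_false, false_and, or_false] at this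
      exact this

/-! ### Structure of `ℒ` and of joins -/

theorem FamilyL.finite_vertexSet {H : Hypergraph α} (hH : H.FamilyL) : V(H).Finite := by
  induction hH with
  | oneVertex v => exact Set.finite_singleton v
  | join _ _ _ _ _ _ ih₁ ih₂ => exact (ih₁.union ih₂).union (Set.finite_singleton _)

theorem FamilyL.nonempty_of_mem_edgeSet {H : Hypergraph α} (hH : H.FamilyL) :
    ∀ e ∈ E(H), e.Nonempty := by
  induction hH with
  | oneVertex v =>
    rintro e rfl
    exact Set.singleton_nonempty v
  | join _ _ _ _ _ _ ih₁ ih₂ =>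
    rintro e ⟨(h | h) | rfl | rfl, -⟩
    · exact ih₁ e h
    · exact ih₂ e h
    · exact ⟨_, .inr rfl⟩
    · exact ⟨_, .inr rfl⟩

theorem FamilyL.vertexSet_nonempty {H : Hypergraph α} (hH : H.FamilyL) : V(H).Nonempty := by
  cases hH with
  | oneVertex v => exact ⟨v, rfl⟩
  | join _ _ _ _ _ _ => exact ⟨_, .inr rfl⟩

theorem ne_of_disjoint_vertexSet {H₁ H₂ : Hypergraph α} (hdisj : Disjoint V(H₁) V(H₂))
    {e f : Set α} (he : e ∈ E(H₁)) (hf : f ∈ E(H₂)) (hne : e.Nonempty) : e ≠ f := by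
  rintro rfl
  obtain ⟨x, hx⟩ := hne
  exact Set.disjoint_left.1 hdisj (H₁.subset_vertexSet_of_mem_edgeSet' he hx)
    (H₂.subset_vertexSet_of_mem_edgeSet' hf hx)

theorem notMem_of_notMem_vertexSet {H : Hypergraph α} {e : Set α} (he : e ∈ E(H)) {x : α}
    (hx : x ∉ V(H)) : x ∉ e :=
  fun h => hx (H.subset_vertexSet_of_mem_edgeSet' he h)

/-- Transfers facts about the first summand to the second. -/
theorem join_comm (H₁ H₂ : Hypergraph α) (e₁ e₂ : Set α) (he₁ : e₁ ∈ E(H₁)) (he₂ : e₂ ∈ E(H₂))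
    (z : α) : join H₁ H₂ e₁ e₂ he₁ he₂ z = join H₂ H₁ e₂ e₁ he₂ he₁ z := by
  simp only [join, Hypergraph.mk.injEq]
  rw [Set.union_comm V(H₁), Set.union_comm E(H₁), Set.pair_comm e₁, Set.pair_comm (e₁ ∪ {z})]
  exact ⟨rfl, rfl⟩

section Join

variable {H₁ H₂ : Hypergraph α} {e₁ e₂ : Set α} {he₁ : e₁ ∈ E(H₁)} {he₂ : e₂ ∈ E(H₂)} {z : α}

/-- An edge of the first summand other than the specified one is an edge of the join. -/
theorem mem_edgeSet_join_of_ne (h₁ : H₁.FamilyL) (hdisj : Disjoint V(H₁) V(H₂)) {e : Set α}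
    (he : e ∈ E(H₁)) (hne : e ≠ e₁) : e ∈ E(join H₁ H₂ e₁ e₂ he₁ he₂ z) := by
  refine ⟨.inl (.inl he), ?_⟩
  rintro (h | h)
  · exact hne h
  · exact ne_of_disjoint_vertexSet hdisj he he₂ (h₁.nonempty_of_mem_edgeSet e he) h

/-- The extended edge of the first summand is an edge of the join. -/
theorem union_mem_edgeSet_join (hz : z ∉ V(H₁) ∪ V(H₂)) :
    e₁ ∪ {z} ∈ E(join H₁ H₂ e₁ e₂ he₁ he₂ z) := by
  refine ⟨.inr (.inl rfl), ?_⟩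
  rintro (h | h)
  · exact notMem_of_notMem_vertexSet he₁ (fun h => hz (.inl h)) (h ▸ .inr rfl)
  · exact notMem_of_notMem_vertexSet he₂ (fun h => hz (.inr h)) (h ▸ .inr rfl)

/-- Every edge of the first summand lies, up to the vertex `z`, above an edge of the join. -/
theorem exists_edge_join_subset (h₁ : H₁.FamilyL) (hdisj : Disjoint V(H₁) V(H₂))
    (hz : z ∉ V(H₁) ∪ V(H₂)) {e : Set α} (he : e ∈ E(H₁)) :
    ∃ f ∈ E(join H₁ H₂ e₁ e₂ he₁ he₂ z), e ⊆ f ∧ f ⊆ e ∪ {z} := by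
  by_cases h : e = e₁
  · subst h
    exact ⟨_, union_mem_edgeSet_join hz, Set.subset_union_left, subset_rfl⟩
  · exact ⟨e, mem_edgeSet_join_of_ne h₁ hdisj he h, subset_rfl, Set.subset_union_left⟩

end Join

/-! ### Maker's strategy -/

/-- Maker wins if, up to the vertices he has claimed, the edges contain those of a member of `ℒ`
all of whose vertices are unclaimed. -/
theorem FamilyL.makerForces {K : Hypergraph α} (hK : K.FamilyL) {H : Hypergraph α}
    (hfin : V(H).Finite) : ∀ M B : Set α, V(K) ⊆ H.unclaimed M B →
      (∀ e ∈ E(K), ∃ f ∈ E(H), f ⊆ e ∪ M) → H.MakerForces .maker M B := by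
  induction hK with
  | oneVertex v =>
    intro M B hV hE
    obtain ⟨f, hf, hfM⟩ := hE {v} rfl
    exact .makerMove v (hV rfl) (.of_edge_subset hf _ _ _ _ hfin.sdiff rfl hfM)
  | @join H₁ H₂ h₁ h₂ hdisj e₁ e₂ he₁ he₂ z hz ih₁ ih₂ =>
    intro M B hV hE
    have hz₁ : z ∉ V(H₁) := fun h => hz (.inl h)
    have hz₂ : z ∉ V(H₂) := fun h => hz (.inr h)
    have hV₁ : V(H₁) ⊆ H.unclaimed (insert z M) B := fun x hx => by
      rw [unclaimed_insert_left]
      exact ⟨hV (.inl (.inl hx)), fun h => hz₁ (h ▸ hx)⟩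
    have hV₂ : V(H₂) ⊆ H.unclaimed (insert z M) B := fun x hx => by
      rw [unclaimed_insert_left]
      exact ⟨hV (.inl (.inr hx)), fun h => hz₂ (h ▸ hx)⟩
    have hsub : ∀ {e g f : Set α}, g ⊆ e ∪ {z} → f ⊆ g ∪ M → f ⊆ e ∪ insert z M := by
      intro e g f hg hf
      rw [Set.insert_eq, ← Set.union_assoc]
      exact hf.trans (Set.union_subset_union_left M hg)
    refine .makerMove z (hV (.inr rfl)) (.breakerMove (h₁.vertexSet_nonempty.mono hV₁) ?_)
    intro y _
    -- The negative case includes replies outside both summands; `H₁` is untouched in all of it.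
    by_cases hy : y ∈ V(H₁)
    · have hy₂ : y ∉ V(H₂) := Set.disjoint_left.1 hdisj hy
      refine ih₂ _ _ (fun x hx => ?_) fun e he => ?_
      · rw [unclaimed_insert_right]
        exact ⟨hV₂ hx, fun h => hy₂ (h ▸ hx)⟩
      · obtain ⟨g, hg, -, hge⟩ := exists_edge_join_subset (he₁ := he₂) (he₂ := he₁) h₂ hdisj.symm
          (Set.union_comm V(H₁) _ ▸ hz) he
        obtain ⟨f, hf, hfg⟩ := hE g (join_comm H₁ H₂ e₁ e₂ he₁ he₂ z ▸ hg)
        exact ⟨f, hf, hsub hge hfg⟩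
    · refine ih₁ _ _ (fun x hx => ?_) fun e he => ?_
      · rw [unclaimed_insert_right]
        exact ⟨hV₁ hx, fun h => hy (h ▸ hx)⟩
      · obtain ⟨g, hg, -, hge⟩ := exists_edge_join_subset (he₁ := he₁) (he₂ := he₂) h₁ hdisj hz he
        obtain ⟨f, hf, hfg⟩ := hE g hg
        exact ⟨f, hf, hsub hge hfg⟩

theorem FamilyL.exists_mem_edge {H : Hypergraph α} (hH : H.FamilyL) :
    ∀ x ∈ V(H), ∃ e ∈ E(H), x ∈ e := by
  induction hH with
  | oneVertex v => exact fun x hx => ⟨{v}, rfl, hx⟩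
  | @join H₁ H₂ h₁ h₂ hdisj e₁ e₂ he₁ he₂ z hz ih₁ ih₂ =>
    rintro x ((hx | hx) | rfl)
    · obtain ⟨e, he, hxe⟩ := ih₁ x hx
      obtain ⟨f, hf, hef, -⟩ := exists_edge_join_subset (he₁ := he₁) (he₂ := he₂) h₁ hdisj hz he
      exact ⟨f, hf, hef hxe⟩
    · obtain ⟨e, he, hxe⟩ := ih₂ x hx
      obtain ⟨f, hf, hef, -⟩ := exists_edge_join_subset (he₁ := he₂) (he₂ := he₁) h₂ hdisj.symm
        (Set.union_comm V(H₁) _ ▸ hz) he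
      exact ⟨f, join_comm H₁ H₂ e₁ e₂ he₁ he₂ z ▸ hf, hef hxe⟩
    · exact ⟨_, union_mem_edgeSet_join hz, .inr rfl⟩

/-! ### Breaker's pairings after deleting an edge -/

/-- `R` is a pairing of vertices of `H` that leaves some vertex of `e` unpaired and has a pair in
every edge other than `e`. -/
structure IsPairingAvoiding (H : Hypergraph α) (e : Set α) (R : α → α → Prop) : Prop
    extends IsPairing R where
  mem : ∀ {x y}, R x y → x ∈ V(H)
  exists_free : ∃ v ∈ e, ∀ y, ¬ R v y
  exists_pair : ∀ f ∈ E(H), f ≠ e → ∃ x ∈ f, ∃ y ∈ f, R x y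

/-- Pairings of the two summands, together with the pair of `z` and the unpaired vertex of `e₂`,
form a pairing of the join. -/
theorem IsPairingAvoiding.join {H₁ H₂ : Hypergraph α} (hdisj : Disjoint V(H₁) V(H₂))
    {e₁ e₂ : Set α} (he₁ : e₁ ∈ E(H₁)) (he₂ : e₂ ∈ E(H₂)) {z : α} (hz : z ∉ V(H₁) ∪ V(H₂))
    {e e' : Set α} (he : e ∈ E(H₁)) (hee' : e ⊆ e') (he' : e = e₁ → e' = e₁ ∪ {z})
    (hne : e ≠ e₁ → e' = e) {R₁ R₂ : α → α → Prop} (h₁ : IsPairingAvoiding H₁ e R₁)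
    (h₂ : IsPairingAvoiding H₂ e₂ R₂) :
    ∃ R, IsPairingAvoiding (join H₁ H₂ e₁ e₂ he₁ he₂ z) e' R := by
  obtain ⟨v, hv, hvR⟩ := h₂.exists_free
  obtain ⟨w, hw, hwR⟩ := h₁.exists_free
  have hz₁ : z ∉ V(H₁) := fun h => hz (.inl h)
  have hz₂ : z ∉ V(H₂) := fun h => hz (.inr h)
  have hvV : v ∈ V(H₂) := H₂.subset_vertexSet_of_mem_edgeSet' he₂ hv
  have hwV : w ∈ V(H₁) := H₁.subset_vertexSet_of_mem_edgeSet' he hw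
  have hd : ∀ x, x ∈ V(H₁) → x ∉ V(H₂) := fun _ hx => Set.disjoint_left.1 hdisj hx
  have m₁ := @h₁.mem
  have m₂ := @h₂.mem
  refine ⟨fun x y => R₁ x y ∨ R₂ x y ∨ (x = v ∧ y = z) ∨ (x = z ∧ y = v), ⟨⟨?_, ?_, ?_⟩,
    ?_, ⟨w, hee' hw, ?_⟩, ?_⟩⟩
  · rintro x y (h | h | h | h)
    · exact .inl (h₁.symm h)
    · exact .inr (.inl (h₂.symm h))
    · exact .inr (.inr (.inr h.symm))
    · exact .inr (.inr (.inl h.symm))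
  · rintro x y (h | h | ⟨rfl, rfl⟩ | ⟨rfl, rfl⟩)
    · exact h₁.ne h
    · exact h₂.ne h
    · exact fun h => hz₂ (h ▸ hvV)
    · exact fun h => hz₂ (h ▸ hvV)
  -- The supports of `R₁`, `R₂` and the pair of `v` and `z` are disjoint, since `v` is unpaired in
  -- `R₂`.
  · have u₁ := @h₁.unique
    have u₂ := @h₂.unique
    grind
  · rintro x y (h | h | ⟨rfl, -⟩ | ⟨rfl, -⟩)
    · exact .inl (.inl (h₁.mem h))
    · exact .inl (.inr (h₂.mem h))
    · exact .inl (.inr hvV)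
    · exact .inr rfl
  · grind
  · rintro f ⟨(hf | hf) | rfl | rfl, hfe⟩ hfe'
    · have hfe₁ : f ≠ e₁ := fun h => hfe (.inl h)
      have : f ≠ e := fun h => hfe' (by rw [hne (h ▸ hfe₁), h])
      obtain ⟨x, hx, y, hy, h⟩ := h₁.exists_pair f hf this
      exact ⟨x, hx, y, hy, .inl h⟩
    · obtain ⟨x, hx, y, hy, h⟩ := h₂.exists_pair f hf fun h => hfe (.inr h)
      exact ⟨x, hx, y, hy, .inr (.inl h)⟩
    -- Here `e ≠ e₁`, so `R₁` already has a pair inside `e₁`.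
    · obtain ⟨x, hx, y, hy, h⟩ := h₁.exists_pair e₁ he₁ fun h => hfe' (he' h.symm).symm
      exact ⟨x, .inl hx, y, .inl hy, .inl h⟩
    · exact ⟨v, .inl hv, z, .inr rfl, .inr (.inr (.inl ⟨rfl, rfl⟩))⟩

theorem FamilyL.exists_isPairingAvoiding {H : Hypergraph α} (hH : H.FamilyL) :
    ∀ e ∈ E(H), ∃ R, IsPairingAvoiding H e R := by
  induction hH with
  | oneVertex v =>
    rintro e rfl
    exact ⟨fun _ _ => False, ⟨⟨False.elim, False.elim, fun h => h.elim⟩, False.elim,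
      ⟨v, rfl, fun _ => id⟩, fun f hf hne => (hne hf).elim⟩⟩
  | @join H₁ H₂ h₁ h₂ hdisj e₁ e₂ he₁ he₂ z hz ih₁ ih₂ =>
    -- The summand containing the avoided edge uses a pairing avoiding that edge (`eᵢ` if it is `eᵢ
    -- ∪ {z}`); the other always avoids its specified edge, which the pair with `z` takes care of.
    obtain ⟨R₁, hR₁⟩ := ih₁ e₁ he₁
    obtain ⟨R₂, hR₂⟩ := ih₂ e₂ he₂
    have hz' : z ∉ V(H₂) ∪ V(H₁) := Set.union_comm V(H₁) _ ▸ hz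
    rintro e ⟨(he | he) | rfl | rfl, hne⟩
    · obtain ⟨R, hR⟩ := ih₁ e he
      exact hR.join hdisj he₁ he₂ hz he subset_rfl (fun h => (hne (.inl h)).elim) (fun _ => rfl) hR₂
    · obtain ⟨R, hR⟩ := ih₂ e he
      rw [join_comm]
      exact hR.join hdisj.symm he₂ he₁ hz' he subset_rfl (fun h => (hne (.inr h)).elim)
        (fun _ => rfl) hR₁
    · exact hR₁.join hdisj he₁ he₂ hz he₁ Set.subset_union_left (fun _ => rfl)
        (fun h => (h rfl).elim) hR₂
    · rw [join_comm]
      exact hR₂.join hdisj.symm he₂ he₁ hz' he₂ Set.subset_union_left (fun _ => rfl)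
        (fun h => (h rfl).elim) hR₁

theorem FamilyL.breakerWins_deleteEdge {H : Hypergraph α} (hH : H.FamilyL) {e : Set α}
    (he : e ∈ E(H)) : (H.deleteEdge e).BreakerWins := by
  obtain ⟨R, hR⟩ := hH.exists_isPairingAvoiding e he
  refine BreakerForces.of_pairing hR.toIsPairing (fun f hf => ?_) _ _ _
    (Set.Finite.sdiff (s := V(H)) hH.finite_vertexSet) rfl fun x y hxy => .inr (.inr ?_)
  · exact hR.exists_pair f hf.1 hf.2
  · simp only [unclaimed, Set.union_self, Set.sdiff_empty]
    exact ⟨hR.mem hxy, hR.mem (hR.symm hxy)⟩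

end Hypergraph

theorem mainTheorem6 {α : Type*} (H : Hypergraph α) (hH : H.FamilyL) :
    H.IsAtomicMakerBreakerCritical where
  finite_vertexSet := hH.finite_vertexSet
  nonempty_of_mem_edgeSet := hH.nonempty_of_mem_edgeSet
  makerWins := hH.makerForces hH.finite_vertexSet ∅ ∅ (by simp [Hypergraph.unclaimed])
    fun e he => ⟨e, he, Set.subset_union_left⟩
  breakerWins_deleteEdge _ he := hH.breakerWins_deleteEdge he
  not_isIsolated x hx h := by
    obtain ⟨e, he, hxe⟩ := hH.exists_mem_edge x hx
    exact h e he hxe
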